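/- **Setting.** Let $\mathbb{Z}^2_{\mathrm{even}}=\{(x,t)\in\mathbb{Z}^2 : x+t \text{ even}\}$. The dynamical discrete web is defined as follows. Each $z\in\mathbb{Z}^2_{\mathrm{even}}$ carries a rate one Poisson clock, i.e. its waiting times between consecutive rings (the first being counted from dynamical time $0$) are i.i.d. $\mathrm{Exp}(1)$, and a sequence of i.i.d. symmetric $\pm1$-valued arrows; all clocks and arrows at all sites are independent. At dynamical time $\tau\ge 0$ let $\xi^\tau_z$ be the $n$-th arrow of $z$ (starting from $n=0$), where $n$ is the number of rings of the clock at $z$ in $[0,\tau]$; that is, the arrow at $z$ is replaced by a new, independent one whenever the clock at $z$ rings. Let $S_0^\tau(t)$, $t=0,1,2,\dots$, be the path with $S_0^\tau(0)=0$ that follows the arrows present at dynamical time $\tau$: $S_0^\tau(t+1)=S_0^\tau(t)+\xi^\tau_{(S_0^\tau(t),t)}$. For $K\in\mathbb{R}$ and integers $j\ge 0$ put $$T_j^{\pm}(K)=\{\tau\in[0,\infty): |S_0^{\tau}(t)|\le j+K\sqrt t\ \ \forall t\ge 0\},\qquad T^{\pm}(K)=\bigcup_{j\ge 0}T_j^{\pm}(K),$$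 $$\hat T^{\pm}(K)=\{\tau\in[0,\infty): \exists N,j \text{ such that } |S_0^{\tau}(t)|\le j+K\sqrt t\ \ \forall t\ge N\}.$$ **Proposition.** For every $K$, the Hausdorff dimensions of the random sets $\hat T^{\pm}(K)$ and $T^{\pm}(K)$ are almost surely equal to one and the same constant: there is a constant $d=d(K)$ such that, almost surely, $$\dim_H(\hat T^{\pm}(K))=d=\dim_H(T^{\pm}(K)).$$ -/

import Mathlib

open MeasureTheory ProbabilityTheory
open scoped ENNReal

/-- The even sublattice `{(x, t) ∈ ℤ² : x + t even}`; the first coordinate is space, the second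
one is the (random walk) time. -/
abbrev EvenSite : Type := {p : ℤ × ℤ // Even (p.1 + p.2)}

namespace EvenSite

/-- The site `(0, 0)`. -/
def origin : EvenSite := ⟨(0, 0), by simp⟩

/-- The endpoint of the arrow leaving a site: `(x + 1, t + 1)` for an arrow pointing right
(`true`), `(x - 1, t + 1)` for an arrow pointing left (`false`). -/
def next (z : EvenSite) (b : Bool) : EvenSite :=
  ⟨(z.1.1 + (if b then 1 else -1), z.1.2 + 1), by
    have h := Int.even_iff.mp z.2
    rw [Int.even_iff]
    cases b <;> simp only [Bool.false_eq_true, if_true, if_false] <;> omega⟩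

end EvenSite

/-- A dynamical discrete web on the probability space `(Ω, P)`, given by its sources of
randomness. Every even site `z` carries

* a rate one Poisson clock, with i.i.d. exponential waiting times `gap z 0, gap z 1, …` between
  consecutive rings (the first one being counted from dynamical time `0`);
* i.i.d. fair arrows `arrow z 0, arrow z 1, …`, where `arrow z 0` is the initial arrow and
  `arrow z n` is the arrow installed at the `n`-th ring of the clock.

All the waiting times and arrows, of all sites, are independent. -/
structure DynamicalDiscreteWeb (Ω : Type*) [MeasurableSpace Ω] (P : Measure Ω) where
  gap : EvenSite → ℕ → Ω → ℝ
  arrow : EvenSite → ℕ → Ω → Bool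
  measurable_gap : ∀ z n, Measurable (gap z n)
  measurable_arrow : ∀ z n, Measurable (arrow z n)
  /-- Each pair consists of an `Exp(1)` variable and an independent fair coin. -/
  law : ∀ z n, P.map (fun ω => (gap z n ω, arrow z n ω)) =
    (expMeasure 1).prod (PMF.uniformOfFintype Bool).toMeasure
  /-- The pairs are independent over all sites and all `n`. -/
  indep : iIndepFun (fun (i : EvenSite × ℕ) ω => (gap i.1 i.2 ω, arrow i.1 i.2 ω)) P

namespace DynamicalDiscreteWeb

variable {Ω : Type*} [MeasurableSpace Ω] {P : Measure Ω}

/-- The dynamical time of the `(n + 1)`-st ring of the clock at `z`. -/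
noncomputable def ringTime (W : DynamicalDiscreteWeb Ω P) (ω : Ω) (z : EvenSite) (n : ℕ) : ℝ :=
  ∑ i ∈ Finset.range (n + 1), W.gap z i ω

/-- The number of rings of the clock at `z` during `[0, τ]` (almost surely finite for all `τ`). -/
noncomputable def ringCount (W : DynamicalDiscreteWeb Ω P) (ω : Ω) (z : EvenSite) (τ : ℝ) : ℕ :=
  {n : ℕ | W.ringTime ω z n ≤ τ}.ncard

/-- The arrow at `z` at dynamical time `τ`: the one installed at the last ring in `[0, τ]`, or the
initial one if the clock has not rung yet. -/
noncomputable def xi (W : DynamicalDiscreteWeb Ω P) (ω : Ω) (τ : ℝ) (z : EvenSite) : Bool :=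
  W.arrow z (W.ringCount ω z τ) ω

/-- `S^τ_z(t)`, for `t ≥` the time coordinate of `z`: the space coordinate at walk time `t` of the
path that starts at `z` and follows the arrows present at dynamical time `τ`. -/
noncomputable def S (W : DynamicalDiscreteWeb Ω P) (ω : Ω) (τ : ℝ) (z : EvenSite) (t : ℤ) : ℤ :=
  ((fun y : EvenSite => y.next (W.xi ω τ y))^[(t - z.1.2).toNat] z).1.1

/-- `T_j^±(K)`: the dynamical times at which `|S_0^τ(t)| ≤ j + K √t` for all `t ≥ 0`. -/
def T (W : DynamicalDiscreteWeb Ω P) (j : ℕ) (K : ℝ) (ω : Ω) : Set ℝ :=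
  {τ | 0 ≤ τ ∧ ∀ t : ℕ, |(W.S ω τ EvenSite.origin t : ℝ)| ≤ j + K * √(t : ℝ)}

/-- `T^±(K) = ⋃_{j ≥ 0} T_j^±(K)`. -/
def TInfty (W : DynamicalDiscreteWeb Ω P) (K : ℝ) (ω : Ω) : Set ℝ :=
  ⋃ j : ℕ, W.T j K ω

/-- The dynamical times at which `S_0^τ` is eventually `K`-subdiffusive: for some `N, j`,
`|S_0^τ(t)| ≤ j + K √t` for all `t ≥ N`. -/
def THat (W : DynamicalDiscreteWeb Ω P) (K : ℝ) (ω : Ω) : Set ℝ :=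
  {τ | 0 ≤ τ ∧ ∃ N j : ℕ, ∀ t : ℕ, N ≤ t →
    |(W.S ω τ EvenSite.origin t : ℝ)| ≤ j + K * √(t : ℝ)}

end DynamicalDiscreteWeb

/-!
The sets `THat` and `TInfty` coincide for every realization: the path moves by one unit per step, so
enlarging `j` removes the constraint at the finitely many walk times before `N`
(`THat_eq_TInfty`). It remains to see that the dimension of `TInfty` is almost surely constant, with
a constant that depends only on the law of the marks, i.e. of all waiting times and arrows. All webs
share this law (`map_marks`), so the constant may be computed on the space of marks itself
(`canonical`).

The dimension is constant because of a zero-one law in dynamical time. Looking at the web from a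
later dynamical time `s` replaces the marks of each site by the residual waiting time, the current
arrow and all later marks (`webShift`). By the lack of memory of the exponential law this shift
preserves the law, and the shifted marks are independent of the marks used up by time `s`
(`siteLaw_exactRings_inter_shiftAt`, `webLaw_pi_history_inter_webShift`). The exceptional times of
the shifted web are those after `s`, translated by `s`, so the shift can only lower the dimension
(`dimH_TInfty_webShift_le`); as it preserves the law, it almost surely leaves the dimension
unchanged. Every event `{dimension > c}` is therefore almost surely a function of the shifted marks
for all `s`, so it is independent of any finite collection of marks, hence of itself
(`webLaw_eq_zero_or_one`).

This argument needs the dimension to be a random variable. Arrows are right-continuous in dynamical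
time, so up to the countable set of ring times `T j K` is, on bounded time intervals, a decreasing
intersection of closures of random sets of rationals, each of them defined by the path up to a
finite walk time (`dimH_TInfty_eq_iSup`). For such compact sets the Hausdorff measure vanishes if and only
if there are finite coverings by rational intervals with small Hausdorff sums
(`IsCompact.hausdorffMeasure_eq_zero_iff`), and this involves countably many events only
(`measurable_dimH_iInter_closure`).
-/

section AlmostSureDimension

open Set Filter Topology

/-! ### Hausdorff dimension of random compact sets of reals -/

/-- A set of reals of diameter at most one is contained in an open interval with rational
endpoints whose length, raised to the power `q`, barely exceeds the contribution of the set to the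
`q`-dimensional Hausdorff sum. -/
lemma exists_rat_Ioo_rpow_le {q : ℝ} (hq : 0 < q) {t : Set ℝ} (ht : Metric.ediam t ≤ 1)
    {ε : ℝ≥0∞} (hε : ε ≠ 0) :
    ∃ p : ℚ × ℚ, t ⊆ Ioo (p.1 : ℝ) p.2 ∧
      ENNReal.ofReal ((p.2 : ℝ) - p.1) ^ q ≤ (⨆ _ : t.Nonempty, Metric.ediam t ^ q) + ε := by
  rcases t.eq_empty_or_nonempty with rfl | hne
  · exact ⟨(0, 0), by simp, by simp [hq]⟩
  have hfin : Metric.ediam t ≠ ⊤ := (ht.trans_lt ENNReal.one_lt_top).ne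
  have hb : Bornology.IsBounded t := Metric.isBounded_iff_ediam_ne_top.mpr hfin
  have hcont : Continuous fun δ : ℝ => ENNReal.ofReal (sSup t - sInf t + 2 * δ) ^ q :=
    (ENNReal.continuous_rpow_const).comp (ENNReal.continuous_ofReal.comp (by fun_prop))
  have hlt : ENNReal.ofReal (sSup t - sInf t + 2 * 0) ^ q < Metric.ediam t ^ q + ε := by
    rw [mul_zero, add_zero, ← Real.ediam_eq hb]
    exact ENNReal.lt_add_right (ENNReal.rpow_ne_top_of_nonneg hq.le hfin) hε
  obtain ⟨δ, hδ, hδ0⟩ :=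
    (((hcont.tendsto 0).mono_left nhdsWithin_le_nhds).eventually_lt_const hlt).and
      (self_mem_nhdsWithin : Ioi (0 : ℝ) ∈ 𝓝[>] 0) |>.exists
  replace hδ0 : 0 < δ := hδ0
  obtain ⟨a, ha, ha'⟩ := exists_rat_btwn (sub_lt_self (sInf t) hδ0)
  obtain ⟨b, hb1, hb2⟩ := exists_rat_btwn (lt_add_of_pos_right (sSup t) hδ0)
  refine ⟨(a, b), fun x hx => ⟨ha'.trans_le (csInf_le hb.bddBelow hx),
    (le_csSup hb.bddAbove hx).trans_lt hb1⟩, ?_⟩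
  rw [iSup_pos hne]
  refine le_trans ?_ hδ.le
  gcongr
  dsimp only
  linarith

/-- A compact set of reals has vanishing `q`-dimensional Hausdorff measure if and only if it has
finite coverings by rational intervals with arbitrarily small Hausdorff sums. Only countably many
coverings are involved, which is what makes the condition measurable for a random compact set. -/
lemma IsCompact.hausdorffMeasure_eq_zero_iff {q : ℝ} (hq : 0 < q) {K : Set ℝ} (hK : IsCompact K) :
    μH[q] K = 0 ↔ ∀ n : ℕ, ∃ l : Finset (ℚ × ℚ), K ⊆ ⋃ p ∈ l, Ioo (p.1 : ℝ) p.2 ∧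
      ∑ p ∈ l, ENNReal.ofReal ((p.2 : ℝ) - p.1) ^ q ≤ ((n : ℝ≥0∞) + 1)⁻¹ := by
  constructor
  · intro h n
    have hε : ((n : ℝ≥0∞) + 1)⁻¹ / 2 ≠ 0 := by simp
    rw [Measure.hausdorffMeasure_apply] at h
    have h1 := (le_iSup₂ (f := fun (r : ℝ≥0∞) (_ : 0 < r) =>
        ⨅ (t : ℕ → Set ℝ) (_ : K ⊆ ⋃ n, t n) (_ : ∀ n, Metric.ediam (t n) ≤ r),
          ∑' n, ⨆ _ : (t n).Nonempty, Metric.ediam (t n) ^ q) 1 one_pos).trans_lt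
      (h.trans_lt (pos_iff_ne_zero.mpr hε))
    simp only [iInf_lt_iff] at h1
    obtain ⟨t, htK, ht1, hsum⟩ := h1
    obtain ⟨ε', hε'0, hε'⟩ := ENNReal.exists_pos_sum_of_countable' hε ℕ
    choose p hp hpq using fun i => exists_rat_Ioo_rpow_le hq (ht1 i) (hε'0 i).ne'
    obtain ⟨s, hs⟩ := hK.elim_finite_subcover (fun i => Ioo ((p i).1 : ℝ) (p i).2)
      (fun i => isOpen_Ioo) (htK.trans (iUnion_mono hp))
    refine ⟨s.image p, ?_, ?_⟩
    · simpa using hs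
    · calc ∑ p ∈ s.image p, ENNReal.ofReal ((p.2 : ℝ) - p.1) ^ q
          ≤ ∑ i ∈ s, ENNReal.ofReal (((p i).2 : ℝ) - (p i).1) ^ q := by
            refine Finset.sum_image_le_of_nonneg ?_
            simp
        _ ≤ ∑ i ∈ s, ((⨆ _ : (t i).Nonempty, Metric.ediam (t i) ^ q) + ε' i) :=
            Finset.sum_le_sum fun i _ => hpq i
        _ ≤ ∑' i, ((⨆ _ : (t i).Nonempty, Metric.ediam (t i) ^ q) + ε' i) :=
            ENNReal.sum_le_tsum s
        _ ≤ ((n : ℝ≥0∞) + 1)⁻¹ / 2 + ((n : ℝ≥0∞) + 1)⁻¹ / 2 := by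
            rw [ENNReal.tsum_add]
            exact add_le_add hsum.le hε'.le
        _ = ((n : ℝ≥0∞) + 1)⁻¹ := ENNReal.add_halves _
  · intro h
    choose l hl hsum using h
    have hinv : Tendsto (fun n : ℕ => ((n : ℝ≥0∞) + 1)⁻¹) atTop (𝓝 0) := by
      have := (tendsto_add_atTop_iff_nat 1).mpr ENNReal.tendsto_inv_nat_nhds_zero
      simpa using this
    have hr : Tendsto (fun n : ℕ => (((n : ℝ≥0∞) + 1)⁻¹) ^ q⁻¹) atTop (𝓝 0) := by
      have := (ENNReal.continuous_rpow_const (y := q⁻¹)).tendsto 0 |>.comp hinv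
      rwa [ENNReal.zero_rpow_of_pos (inv_pos.mpr hq)] at this
    have hle : ∀ n, ∑ i : l n, Metric.ediam (Ioo ((i : ℚ × ℚ).1 : ℝ) (i : ℚ × ℚ).2) ^ q ≤
        ((n : ℝ≥0∞) + 1)⁻¹ := fun n => by
      simp only [Real.ediam_Ioo]
      rw [Finset.sum_coe_sort (l n) fun p => ENNReal.ofReal ((p.2 : ℝ) - p.1) ^ q]
      exact hsum n
    refine le_antisymm ((Measure.hausdorffMeasure_le_liminf_sum q K _ hr
      (fun n (i : l n) => Ioo ((i : ℚ × ℚ).1 : ℝ) (i : ℚ × ℚ).2)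
      (Eventually.of_forall fun n i => ?_) (Eventually.of_forall fun n => ?_)).trans ?_) zero_le
    · rw [ENNReal.le_rpow_inv_iff hq]
      exact (Finset.single_le_sum (f := fun i : l n =>
        Metric.ediam (Ioo ((i : ℚ × ℚ).1 : ℝ) (i : ℚ × ℚ).2) ^ q) (fun _ _ => zero_le)
        (Finset.mem_univ i)).trans (hle n)
    · simpa [iUnion_subtype] using hl n
    · rw [← hinv.liminf_eq]
      exact liminf_le_liminf (Eventually.of_forall hle)

/-- Hausdorff dimension through Hausdorff measures of rational exponents. -/
lemma lt_dimH_iff_exists_rat {c : ℝ≥0∞} {K : Set ℝ} :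
    c < dimH K ↔ ∃ q : ℚ, 0 < q ∧ c < ENNReal.ofReal q ∧ μH[(q : ℝ)] K ≠ 0 := by
  constructor
  · intro h
    obtain ⟨r, hr0, hcr, hr⟩ := ENNReal.lt_iff_exists_rat_btwn.mp h
    have hc : c < ENNReal.ofReal r := hcr
    refine ⟨r, ?_, hc, ?_⟩
    · have : (0 : ℝ) < r := ENNReal.ofReal_pos.mp (bot_le.trans_lt hc)
      exact_mod_cast this
    · have := hausdorffMeasure_of_lt_dimH (d := Real.toNNReal r) hr
      rw [Real.coe_toNNReal _ (by exact_mod_cast hr0)] at this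
      rw [this]
      exact ENNReal.top_ne_zero
  · rintro ⟨q, hq0, hcq, hq⟩
    refine hcq.trans_le ?_
    refine le_dimH_of_hausdorffMeasure_ne_zero (d := Real.toNNReal q) ?_
    rwa [Real.coe_toNNReal _ (by exact_mod_cast hq0.le)]

section RandomSet

variable {X : Type*} [MeasurableSpace X]

/-- The event that the closure of a bounded random set of rationals is covered by a fixed open set
is measurable. -/
lemma measurableSet_closure_subset {A : X → Set ℚ} (hA : ∀ q, MeasurableSet {x | q ∈ A x})
    {M : ℝ} (hM : ∀ x, ∀ q ∈ A x, (q : ℝ) ∈ Icc 0 M) {U : Set ℝ} (hU : IsOpen U) :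
    MeasurableSet {x | closure ((↑) '' A x : Set ℝ) ⊆ U} := by
  -- A compact set lies in an open set if and only if some uniform neighbourhood of it does.
  have key : {x | closure ((↑) '' A x : Set ℝ) ⊆ U} = ⋃ m : ℕ, ⋂ q : ℚ,
      ({x | q ∈ A x}ᶜ ∪ {_x | Metric.ball (q : ℝ) (1 / ((m : ℝ) + 1)) ⊆ U}) := by
    ext x
    simp only [mem_ofPred_eq, mem_iUnion, mem_iInter, mem_union, mem_compl_iff,
      ← imp_iff_not_or]
    have hcl : closure ((↑) '' A x : Set ℝ) ⊆ Icc 0 M :=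
      closure_minimal (by rintro _ ⟨q, hq, rfl⟩; exact hM x q hq) isClosed_Icc
    constructor
    · intro h
      obtain ⟨δ, hδ, hsub⟩ := (isCompact_Icc.of_isClosed_subset isClosed_closure
        hcl).exists_thickening_subset_open hU h
      obtain ⟨m, hm⟩ := exists_nat_one_div_lt hδ
      refine ⟨m, fun q hq => (Metric.ball_subset_ball hm.le).trans (Subset.trans ?_ hsub)⟩
      exact Metric.ball_subset_thickening (subset_closure (mem_image_of_mem _ hq)) δ
    · rintro ⟨m, hm⟩ y hy
      obtain ⟨_, ⟨q, hq, rfl⟩, hd⟩ :=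
        Metric.mem_closure_iff.mp hy (1 / ((m : ℝ) + 1)) (by positivity)
      exact hm q hq hd
  rw [key]
  exact .iUnion fun m => .iInter fun q => (hA q).compl.union (.const _)

/-- The Hausdorff dimension of a random compact set, given as a decreasing intersection of closures
of bounded random sets of rationals, is a random variable. -/
lemma measurable_dimH_iInter_closure {A : ℕ → X → Set ℚ}
    (hA : ∀ n q, MeasurableSet {x | q ∈ A n x}) (hanti : ∀ x, Antitone fun n => A n x)
    {M : ℝ} (hM : ∀ n x, ∀ q ∈ A n x, (q : ℝ) ∈ Icc 0 M) :
    Measurable fun x => dimH (⋂ n, closure ((↑) '' A n x : Set ℝ)) := by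
  have hcomp : ∀ n x, IsCompact (closure ((↑) '' A n x : Set ℝ)) := fun n x =>
    isCompact_Icc.of_isClosed_subset isClosed_closure
      (closure_minimal (by rintro _ ⟨q, hq, rfl⟩; exact hM n x q hq) isClosed_Icc)
  have hcomp' : ∀ x, IsCompact (⋂ n, closure ((↑) '' A n x : Set ℝ)) := fun x =>
    (hcomp 0 x).of_isClosed_subset (isClosed_iInter fun n => isClosed_closure)
      (iInter_subset _ 0)
  have hcover : ∀ U : Set ℝ, IsOpen U →
      MeasurableSet {x | ⋂ n, closure ((↑) '' A n x : Set ℝ) ⊆ U} := by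
    intro U hU
    have : {x | ⋂ n, closure ((↑) '' A n x : Set ℝ) ⊆ U} =
        ⋃ n, {x | closure ((↑) '' A n x : Set ℝ) ⊆ U} := by
      ext x
      simp only [mem_ofPred_eq, mem_iUnion]
      constructor
      · intro h
        refine exists_subset_nhds_of_isCompact (V := fun n => closure ((↑) '' A n x : Set ℝ))
          (directed_of_isDirected_le ?_) (fun n => hcomp n x)
          fun y hy => hU.mem_nhds (h hy)
        intro m n hmn
        exact closure_mono (image_mono (hanti x hmn))
      · rintro ⟨n, hn⟩
        exact (iInter_subset _ n).trans hn
    rw [this]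
    exact .iUnion fun n => measurableSet_closure_subset (hA n) (hM n) hU
  refine measurable_of_Ioi fun c => ?_
  have : (fun x => dimH (⋂ n, closure ((↑) '' A n x : Set ℝ))) ⁻¹' Ioi c =
      ⋃ q : ℚ, ⋃ _ : 0 < q ∧ c < ENNReal.ofReal q,
        {x | μH[(q : ℝ)] (⋂ n, closure ((↑) '' A n x : Set ℝ)) = 0}ᶜ := by
    ext x
    simp only [mem_preimage, mem_Ioi, lt_dimH_iff_exists_rat, mem_iUnion, mem_compl_iff,
      mem_ofPred_eq, exists_prop, and_assoc, ne_eq]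
  rw [this]
  refine .iUnion fun q => .iUnion fun hq => MeasurableSet.compl ?_
  have hq0 : (0 : ℝ) < q := by exact_mod_cast hq.1
  have : {x | μH[(q : ℝ)] (⋂ n, closure ((↑) '' A n x : Set ℝ)) = 0} =
      ⋂ n : ℕ, ⋃ l : Finset (ℚ × ℚ), ⋃ _ : ∑ p ∈ l, ENNReal.ofReal ((p.2 : ℝ) - p.1) ^ (q : ℝ) ≤
        ((n : ℝ≥0∞) + 1)⁻¹, {x | ⋂ n, closure ((↑) '' A n x : Set ℝ) ⊆
          ⋃ p ∈ l, Ioo (p.1 : ℝ) p.2} := by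
    ext x
    simp only [mem_ofPred_eq, (hcomp' x).hausdorffMeasure_eq_zero_iff hq0, mem_iInter, mem_iUnion,
      exists_prop, and_comm]
  rw [this]
  exact .iInter fun n => .iUnion fun l => .iUnion fun _ =>
    hcover _ (isOpen_biUnion fun _ _ => isOpen_Ioo)

end RandomSet

/-! ### The law of a mark and the lack of memory -/

instance : IsProbabilityMeasure (expMeasure 1) := isProbabilityMeasure_expMeasure one_pos

lemma expMeasure_one_Ioc (a b : ℝ) : expMeasure 1 (Ioc a b) =
    ENNReal.ofReal ((if 0 ≤ b then 1 - Real.exp (-b) else 0) -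
      (if 0 ≤ a then 1 - Real.exp (-a) else 0)) := by
  rw [← measure_cdf (expMeasure 1), StieltjesFunction.measure_Ioc,
    cdf_expMeasure_eq one_pos, cdf_expMeasure_eq one_pos]
  simp

lemma expMeasure_one_Iic (a : ℝ) : expMeasure 1 (Iic a) =
    ENNReal.ofReal (if 0 ≤ a then 1 - Real.exp (-a) else 0) := by
  rw [← ofReal_cdf, cdf_expMeasure_eq one_pos]
  simp

/-- The exponential law is memoryless. -/
lemma map_sub_restrict_Ioi_expMeasure_one {s : ℝ} (hs : 0 ≤ s) :
    ((expMeasure 1).restrict (Ioi s)).map (fun x => x - s) =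
      ENNReal.ofReal (Real.exp (-s)) • expMeasure 1 := by
  refine Measure.ext_of_Iic _ _ fun a => ?_
  have hpre : (fun x : ℝ => x - s) ⁻¹' Iic a ∩ Ioi s = Ioc s (s + a) := by
    ext x
    simp only [mem_inter_iff, mem_preimage, mem_Iic, mem_Ioi, mem_Ioc]
    constructor <;> rintro ⟨h1, h2⟩ <;> constructor <;> linarith
  rw [Measure.map_apply (by fun_prop) measurableSet_Iic, Measure.restrict_apply
    ((by fun_prop : Measurable fun x : ℝ => x - s) measurableSet_Iic), hpre, Measure.smul_apply,
    expMeasure_one_Iic, smul_eq_mul, ← ENNReal.ofReal_mul (Real.exp_pos _).le,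
    expMeasure_one_Ioc, if_pos hs]
  rcases le_or_gt 0 a with ha | ha
  · rw [if_pos ha, if_pos (by linarith), neg_add, Real.exp_add]
    congr 1
    ring
  · rw [if_neg ha.not_ge, mul_zero, ENNReal.ofReal_zero, ENNReal.ofReal_eq_zero]
    have h1 : Real.exp (-s) ≤ 1 := Real.exp_le_one_iff.mpr (by linarith)
    split_ifs with h
    · have : Real.exp (-s) ≤ Real.exp (-(s + a)) := Real.exp_le_exp.mpr (by linarith)
      linarith
    · linarith

/-- The law of a mark: a waiting time together with the arrow that is present while waiting. -/
noncomputable def markLaw : Measure (ℝ × Bool) :=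
  (expMeasure 1).prod (PMF.uniformOfFintype Bool).toMeasure

instance : IsProbabilityMeasure markLaw := by unfold markLaw; infer_instance

/-- The law of the sequence of marks of one site. -/
noncomputable def siteLaw : Measure (ℕ → ℝ × Bool) := Measure.infinitePi fun _ => markLaw

instance : IsProbabilityMeasure siteLaw := by unfold siteLaw; infer_instance

lemma map_sub_restrict_markLaw {s : ℝ} (hs : 0 ≤ s) :
    (markLaw.restrict {p | s < p.1}).map (fun p => (p.1 - s, p.2)) =
      ENNReal.ofReal (Real.exp (-s)) • markLaw := by
  have h1 : {p : ℝ × Bool | s < p.1} = Ioi s ×ˢ univ := by ext; simp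
  have h2 : (fun p : ℝ × Bool => (p.1 - s, p.2)) = Prod.map (fun x => x - s) id := rfl
  rw [h1, h2, markLaw, ← Measure.prod_restrict, ← Measure.map_prod_map _ _ (by fun_prop)
    measurable_id, map_sub_restrict_Ioi_expMeasure_one hs, Measure.restrict_univ, Measure.map_id,
    Measure.prod_smul_left]

lemma markLaw_fst_le (a : ℝ) : markLaw {p | p.1 ≤ a} =
    ENNReal.ofReal (if 0 ≤ a then 1 - Real.exp (-a) else 0) := by
  have h1 : {p : ℝ × Bool | p.1 ≤ a} = Iic a ×ˢ univ := by ext; simp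
  rw [h1, markLaw, Measure.prod_prod, measure_univ, mul_one, expMeasure_one_Iic]

/-! ### The Markov property of the marks of one site -/

/-- The sequence with first term `p` followed by the sequence `w`. -/
def seqCons {α : Type*} (p : α) (w : ℕ → α) : ℕ → α
  | 0 => p
  | n + 1 => w n

@[simp] lemma seqCons_zero {α : Type*} (p : α) (w : ℕ → α) : seqCons p w 0 = p := rfl

@[simp] lemma seqCons_succ {α : Type*} (p : α) (w : ℕ → α) (n : ℕ) :
    seqCons p w (n + 1) = w n := rfl

lemma measurable_seqCons {α : Type*} [MeasurableSpace α] :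
    Measurable fun p : α × (ℕ → α) => seqCons p.1 p.2 := by
  refine measurable_pi_iff.mpr fun n => ?_
  cases n with
  | zero => exact measurable_fst
  | succ n => exact (measurable_pi_apply n).comp measurable_snd

/-- Splitting off the first mark of a site. -/
lemma map_seqCons_prod_siteLaw :
    (markLaw.prod siteLaw).map (fun p => seqCons p.1 p.2) = siteLaw := by
  classical
  refine Measure.eq_infinitePi _ fun s t ht => ?_
  obtain ⟨n, hn⟩ : ∃ n, s ⊆ Finset.range (n + 1) :=
    ⟨s.sup id, fun i hi => Finset.mem_range_succ_iff.mpr (Finset.le_sup (f := id) hi)⟩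
  set t' : ℕ → Set (ℝ × Bool) := fun i => if i ∈ s then t i else univ with ht'
  have ht'm : ∀ i, MeasurableSet (t' i) := fun i => by
    simp only [ht']; split_ifs; exacts [ht i, .univ]
  have hpre : (fun p : (ℝ × Bool) × (ℕ → ℝ × Bool) => seqCons p.1 p.2) ⁻¹' (s : Set ℕ).pi t =
      t' 0 ×ˢ (Finset.range n : Set ℕ).pi (fun i => t' (i + 1)) := by
    ext ⟨p, w⟩
    simp only [mem_preimage, Set.mem_pi, Finset.mem_coe, mem_prod, Finset.mem_range, ht']
    constructor
    · intro h
      refine ⟨?_, fun i _ => ?_⟩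
      · split_ifs with h0
        exacts [h 0 h0, mem_univ _]
      · split_ifs with h0
        exacts [h (i + 1) h0, mem_univ _]
    · rintro ⟨h0, h1⟩ i hi
      cases i with
      | zero => simpa [hi] using h0
      | succ i => simpa [hi] using h1 i (by simpa using hn hi)
  rw [Measure.map_apply measurable_seqCons (.pi s.countable_toSet fun i _ => ht i), hpre,
    Measure.prod_prod, siteLaw, Measure.infinitePi_pi _ fun i _ => ht'm _, mul_comm,
    ← Finset.prod_range_succ' (fun i => markLaw (t' i)), ← Finset.prod_subset hn]
  · exact Finset.prod_congr rfl fun i hi => by simp [ht', hi]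
  · intro i _ hi
    simp [ht', hi]

/-- The time of the `n`-th ring of a clock with the given marks. -/
def clock (y : ℕ → ℝ × Bool) (n : ℕ) : ℝ := ∑ i ∈ Finset.range n, (y i).1

lemma clock_seqCons (p : ℝ × Bool) (w : ℕ → ℝ × Bool) (n : ℕ) :
    clock (seqCons p w) (n + 1) = p.1 + clock w n := by
  rw [clock, Finset.sum_range_succ', add_comm]
  rfl

@[fun_prop] lemma measurable_clock (n : ℕ) : Measurable fun y => clock y n := by
  unfold clock; fun_prop

/-- The event that the `(n + 1)`-st ring is the first one after time `s`. -/
def exactRings (n : ℕ) (s : ℝ) : Set (ℕ → ℝ × Bool) :=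
  {y | (∀ i < n, clock y (i + 1) ≤ s) ∧ s < clock y (n + 1)}

lemma measurableSet_exactRings (n : ℕ) (s : ℝ) : MeasurableSet (exactRings n s) := by
  have : exactRings n s =
      (⋂ i, ⋂ _ : i < n, {y | clock y (i + 1) ≤ s}) ∩ {y | s < clock y (n + 1)} := by
    ext; simp [exactRings]
  rw [this]
  exact (MeasurableSet.iInter fun i => .iInter fun _ =>
    measurableSet_le (measurable_clock _) measurable_const).inter
    (measurableSet_lt measurable_const (measurable_clock _))

lemma seqCons_mem_exactRings_zero {s : ℝ} {p : ℝ × Bool} {w : ℕ → ℝ × Bool} :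
    seqCons p w ∈ exactRings 0 s ↔ s < p.1 := by
  simp [exactRings, clock]

lemma seqCons_mem_exactRings_succ {n : ℕ} {s : ℝ} {p : ℝ × Bool} {w : ℕ → ℝ × Bool} :
    seqCons p w ∈ exactRings (n + 1) s ↔ p.1 ≤ s ∧ w ∈ exactRings n (s - p.1) := by
  have h0 : clock w 0 = 0 := by simp [clock]
  simp only [exactRings, mem_ofPred_eq, clock_seqCons]
  constructor
  · rintro ⟨h1, h2⟩
    refine ⟨by simpa [h0] using h1 0 n.succ_pos, fun i hi => ?_, by linarith⟩
    linarith [h1 (i + 1) (by omega)]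
  · rintro ⟨h1, h2, h3⟩
    refine ⟨fun i hi => ?_, by linarith⟩
    cases i with
    | zero => simpa [h0] using h1
    | succ i => linarith [h2 i (by omega)]

/-- The marks seen from dynamical time `s`, if `n` rings have occurred by then: the current waiting
time is replaced by what remains of it at time `s`. -/
def shiftAt (n : ℕ) (s : ℝ) (y : ℕ → ℝ × Bool) : ℕ → ℝ × Bool :=
  seqCons (clock y (n + 1) - s, (y n).2) fun k => y (n + (k + 1))

lemma measurable_shiftAt_uncurry (n : ℕ) :
    Measurable fun p : ℝ × (ℕ → ℝ × Bool) => shiftAt n p.1 p.2 := by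
  refine measurable_pi_iff.mpr fun k => ?_
  cases k with
  | zero =>
    simp only [shiftAt, seqCons_zero]
    exact (((measurable_clock _).comp measurable_snd).sub measurable_fst).prodMk (by fun_prop)
  | succ k =>
    simp only [shiftAt, seqCons_succ]
    fun_prop

lemma measurable_shiftAt (n : ℕ) (s : ℝ) : Measurable (shiftAt n s) :=
  (measurable_shiftAt_uncurry n).comp measurable_prodMk_left

lemma shiftAt_zero_seqCons (s : ℝ) (p : ℝ × Bool) (w : ℕ → ℝ × Bool) :
    shiftAt 0 s (seqCons p w) = seqCons (p.1 - s, p.2) w := by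
  funext k
  cases k with
  | zero => simp [shiftAt, clock]
  | succ k => simp [shiftAt]

lemma shiftAt_succ_seqCons (n : ℕ) (s : ℝ) (p : ℝ × Bool) (w : ℕ → ℝ × Bool) :
    shiftAt (n + 1) s (seqCons p w) = shiftAt n (s - p.1) w := by
  funext k
  cases k with
  | zero =>
    simp only [shiftAt, seqCons_zero, clock_seqCons, seqCons_succ]
    congr 1
    ring
  | succ k =>
    simp only [shiftAt, seqCons_succ]
    rw [show n + 1 + (k + 1) = (n + (k + 1)) + 1 by ring, seqCons_succ]

/-- The event that exactly `n` rings occur by time `s` and that the marks before them lie in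
prescribed sets, jointly in the marks and in `s`. -/
lemma measurableSet_exactRings_uncurry (n : ℕ) {b : ℕ → Set (ℝ × Bool)}
    (hb : ∀ i, MeasurableSet (b i)) :
    MeasurableSet {p : ℝ × (ℕ → ℝ × Bool) | p.2 ∈ exactRings n p.1 ∧ ∀ i < n, p.2 i ∈ b i} := by
  have : {p : ℝ × (ℕ → ℝ × Bool) | p.2 ∈ exactRings n p.1 ∧ ∀ i < n, p.2 i ∈ b i} =
      ((⋂ i, ⋂ _ : i < n, {p | clock p.2 (i + 1) ≤ p.1}) ∩ {p | p.1 < clock p.2 (n + 1)}) ∩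
        ⋂ i, ⋂ _ : i < n, {p | p.2 i ∈ b i} := by
    ext; simp [exactRings]
  rw [this]
  refine ((MeasurableSet.iInter fun i => .iInter fun _ => ?_).inter ?_).inter
    (.iInter fun i => .iInter fun _ => ?_)
  · exact measurableSet_le ((measurable_clock _).comp measurable_snd) measurable_fst
  · exact measurableSet_lt measurable_fst ((measurable_clock _).comp measurable_snd)
  · exact ((measurable_pi_apply i).comp measurable_snd) (hb i)

/-- Markov property at dynamical time `s`: on the event that exactly `n` rings have occurred, the
marks seen from time `s` have the original law and are independent of the first `n` marks. The proof
is by induction on `n`, conditioning on the first mark; for `n = 0` it is the lack of memory of the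
exponential law. -/
lemma siteLaw_exactRings_inter_shiftAt (n : ℕ) {s : ℝ} (hs : 0 ≤ s) {b : ℕ → Set (ℝ × Bool)}
    (hb : ∀ i, MeasurableSet (b i)) {A : Set (ℕ → ℝ × Bool)} (hA : MeasurableSet A) :
    siteLaw ({y | y ∈ exactRings n s ∧ ∀ i < n, y i ∈ b i} ∩ shiftAt n s ⁻¹' A) =
      siteLaw {y | y ∈ exactRings n s ∧ ∀ i < n, y i ∈ b i} * siteLaw A := by
  have hmeas : ∀ n s (b : ℕ → Set (ℝ × Bool)), (∀ i, MeasurableSet (b i)) →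
      MeasurableSet {y | y ∈ exactRings n s ∧ ∀ i < n, y i ∈ b i} := fun n s b hb =>
    measurable_prodMk_left (measurableSet_exactRings_uncurry n hb)
  have hcons : ∀ S : Set (ℕ → ℝ × Bool), MeasurableSet S →
      siteLaw S = (markLaw.prod siteLaw) ((fun p => seqCons p.1 p.2) ⁻¹' S) := fun S hS => by
    rw [← Measure.map_apply measurable_seqCons hS, map_seqCons_prod_siteLaw]
  have hmeas' : MeasurableSet
      ({y | y ∈ exactRings n s ∧ ∀ i < n, y i ∈ b i} ∩ shiftAt n s ⁻¹' A) :=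
    (hmeas n s b hb).inter (measurable_shiftAt n s hA)
  induction n generalizing s b with
  | zero =>
    have hset : MeasurableSet {p : ℝ × Bool | s < p.1} :=
      measurableSet_lt measurable_const measurable_fst
    have h1 : (fun p : (ℝ × Bool) × (ℕ → ℝ × Bool) => seqCons p.1 p.2) ⁻¹'
        {y | y ∈ exactRings 0 s ∧ ∀ i < 0, y i ∈ b i} = {p | s < p.1} ×ˢ univ := by
      ext ⟨p, w⟩
      simp [seqCons_mem_exactRings_zero]
    have h2 : (fun p : (ℝ × Bool) × (ℕ → ℝ × Bool) => seqCons p.1 p.2) ⁻¹'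
        ({y | y ∈ exactRings 0 s ∧ ∀ i < 0, y i ∈ b i} ∩ shiftAt 0 s ⁻¹' A) =
        Prod.map (fun p => (p.1 - s, p.2)) id ⁻¹' ((fun p => seqCons p.1 p.2) ⁻¹' A) ∩
          {p | s < p.1} ×ˢ univ := by
      ext ⟨p, w⟩
      simp [seqCons_mem_exactRings_zero, shiftAt_zero_seqCons, and_comm]
    have hmap : Measurable fun p : ℝ × Bool => (p.1 - s, p.2) := by fun_prop
    have hpA := measurable_seqCons hA
    have hc : markLaw {p | s < p.1} = ENNReal.ofReal (Real.exp (-s)) := by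
      have := congrArg (fun μ : Measure (ℝ × Bool) => μ univ) (map_sub_restrict_markLaw hs)
      simpa [Measure.map_apply hmap] using this
    rw [hcons _ hmeas', hcons _ (hmeas 0 s b hb), h1, h2, Measure.prod_prod, measure_univ, mul_one,
      hc, ← Measure.restrict_apply ((hmap.prodMap measurable_id) hpA), ← Measure.prod_restrict,
      ← Measure.map_apply (hmap.prodMap measurable_id) hpA,
      ← Measure.map_prod_map _ _ hmap measurable_id, map_sub_restrict_markLaw hs,
      Measure.restrict_univ, Measure.map_id, Measure.prod_smul_left, Measure.smul_apply,
      ← hcons A hA, smul_eq_mul]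
  | succ n ih =>
    have hb' : ∀ i, MeasurableSet (b (i + 1)) := fun i => hb (i + 1)
    have hm1 := measurable_seqCons (hmeas (n + 1) s b hb)
    rw [hcons _ hmeas', hcons _ (hmeas (n + 1) s b hb),
      Measure.prod_apply (measurable_seqCons hmeas'), Measure.prod_apply hm1,
      ← lintegral_mul_const _ (measurable_measure_prodMk_left hm1)]
    refine lintegral_congr fun p => ?_
    have hforall : ∀ w : ℕ → ℝ × Bool, (∀ i < n + 1, seqCons p w i ∈ b i) ↔
        p ∈ b 0 ∧ ∀ i < n, w i ∈ b (i + 1) := fun w => by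
      constructor
      · exact fun h => ⟨h 0 n.succ_pos, fun i hi => h (i + 1) (by omega)⟩
      · rintro ⟨h0, h1⟩ i hi
        cases i with
        | zero => exact h0
        | succ i => exact h1 i (by omega)
    by_cases hp : p.1 ≤ s ∧ p ∈ b 0
    · have h1 : Prod.mk p ⁻¹' ((fun p : (ℝ × Bool) × (ℕ → ℝ × Bool) => seqCons p.1 p.2) ⁻¹'
          {y | y ∈ exactRings (n + 1) s ∧ ∀ i < n + 1, y i ∈ b i}) =
          {y | y ∈ exactRings n (s - p.1) ∧ ∀ i < n, y i ∈ b (i + 1)} := by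
        ext w
        simp only [mem_preimage, mem_ofPred_eq, seqCons_mem_exactRings_succ, hforall, hp.1, hp.2,
          true_and]
      have h2 : Prod.mk p ⁻¹' ((fun p : (ℝ × Bool) × (ℕ → ℝ × Bool) => seqCons p.1 p.2) ⁻¹'
          ({y | y ∈ exactRings (n + 1) s ∧ ∀ i < n + 1, y i ∈ b i} ∩
            shiftAt (n + 1) s ⁻¹' A)) =
          {y | y ∈ exactRings n (s - p.1) ∧ ∀ i < n, y i ∈ b (i + 1)} ∩
            shiftAt n (s - p.1) ⁻¹' A := by
        ext w
        simp only [mem_preimage, mem_inter_iff, mem_ofPred_eq, seqCons_mem_exactRings_succ, hforall,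
          hp.1, hp.2, true_and, shiftAt_succ_seqCons]
      rw [h1, h2]
      exact ih (sub_nonneg.mpr hp.1) hb'
        ((hmeas n (s - p.1) _ hb').inter (measurable_shiftAt n _ hA))
    · have h1 : Prod.mk p ⁻¹' ((fun p : (ℝ × Bool) × (ℕ → ℝ × Bool) => seqCons p.1 p.2) ⁻¹'
          {y | y ∈ exactRings (n + 1) s ∧ ∀ i < n + 1, y i ∈ b i}) = ∅ := by
        ext w
        simp only [mem_preimage, mem_ofPred_eq, seqCons_mem_exactRings_succ, hforall,
          mem_empty_iff_false, iff_false]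
        tauto
      rw [preimage_inter, preimage_inter, h1, empty_inter, measure_empty, zero_mul]

/-! ### Regularity of clocks and the shift of one site -/

/-- The almost sure regularity of a clock: positive waiting times and finitely many rings in bounded
time. -/
def ClockRegular (y : ℕ → ℝ × Bool) : Prop :=
  (∀ n, 0 < (y n).1) ∧ Tendsto (clock y) atTop atTop

lemma monotone_clock {y : ℕ → ℝ × Bool} (hy : ∀ n, 0 < (y n).1) : Monotone (clock y) :=
  monotone_nat_of_le_succ fun n => by
    have := hy n
    simp only [clock, Finset.sum_range_succ]
    linarith

/-- The probability that `k` given waiting times are all at most one decays geometrically in `k`. -/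
lemma ae_frequently_one_lt_fst : ∀ᵐ y ∂siteLaw, ∃ᶠ n in atTop, 1 < (y n).1 := by
  simp_rw [frequently_atTop]
  refine ae_all_iff.mpr fun n => ?_
  have hq : markLaw {p | p.1 ≤ 1} < 1 := by
    rw [markLaw_fst_le, if_pos zero_le_one, ← ENNReal.ofReal_one]
    exact (ENNReal.ofReal_lt_ofReal_iff one_pos).mpr (by linarith [Real.exp_pos (-1)])
  have hlim := ENNReal.tendsto_pow_atTop_nhds_zero_of_lt_one hq
  refine le_antisymm (ge_of_tendsto' hlim fun k => ?_) zero_le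
  calc siteLaw {y | ∃ m ≥ n, 1 < (y m).1}ᶜ
      ≤ siteLaw ((Finset.Ico n (n + k) : Set ℕ).pi fun _ => {p | p.1 ≤ 1}) := by
        refine measure_mono fun y hy i hi => ?_
        simp only [mem_compl_iff, mem_ofPred_eq, not_exists, not_and, not_lt] at hy
        exact hy i (Finset.mem_Ico.mp hi).1
    _ = markLaw {p | p.1 ≤ 1} ^ k := by
        rw [siteLaw, Measure.infinitePi_pi _ fun _ _ =>
          measurableSet_le measurable_fst measurable_const]
        simp

lemma ae_clockRegular : ∀ᵐ y ∂siteLaw, ClockRegular y := by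
  have hpos : ∀ᵐ y ∂siteLaw, ∀ n, 0 < (y n).1 := by
    refine ae_all_iff.mpr fun n => ?_
    have h0 : ∀ᵐ p ∂markLaw, 0 < p.1 := by
      rw [ae_iff, show {p : ℝ × Bool | ¬ 0 < p.1} = {p | p.1 ≤ 0} by ext; simp, markLaw_fst_le]
      simp
    exact (measurePreserving_eval_infinitePi (fun _ : ℕ => markLaw) n).quasiMeasurePreserving.ae h0
  filter_upwards [hpos, ae_frequently_one_lt_fst] with y hy hy1
  refine ⟨hy, tendsto_atTop_atTop_of_monotone (monotone_clock hy) fun b => ?_⟩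
  -- Every further waiting time larger than one moves the clock beyond the next integer.
  have hN : ∀ N : ℕ, ∃ n, (N : ℝ) ≤ clock y n := by
    intro N
    induction N with
    | zero => exact ⟨0, by simp [clock]⟩
    | succ N ih =>
      obtain ⟨n, hn⟩ := ih
      obtain ⟨m, hnm, hm⟩ := frequently_atTop.mp hy1 n
      refine ⟨m + 1, ?_⟩
      have := monotone_clock hy hnm
      rw [clock, Finset.sum_range_succ, ← clock]
      push_cast
      linarith
  obtain ⟨N, hN'⟩ := exists_nat_ge b
  obtain ⟨n, hn⟩ := hN N
  exact ⟨n, hN'.trans hn⟩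

/-- The number of rings of a clock up to time `s`, for a clock that rings again after `s`; for other
clocks the infimum is over the empty set and equals `0`. -/
noncomputable def ringsUpTo (s : ℝ) (y : ℕ → ℝ × Bool) : ℕ := sInf {n | s < clock y (n + 1)}

/-- The marks of a site seen from dynamical time `s`. -/
noncomputable def siteShift (s : ℝ) (y : ℕ → ℝ × Bool) : ℕ → ℝ × Bool :=
  shiftAt (ringsUpTo s y) s y

lemma ringsUpTo_eq_of_mem_exactRings {n : ℕ} {s : ℝ} {y : ℕ → ℝ × Bool}
    (hy : y ∈ exactRings n s) : ringsUpTo s y = n := by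
  refine le_antisymm (Nat.sInf_le hy.2) ?_
  by_contra! h
  have hmem : ringsUpTo s y ∈ {n | s < clock y (n + 1)} := Nat.sInf_mem ⟨n, hy.2⟩
  exact absurd (hy.1 _ h) (not_le.mpr hmem)

lemma mem_exactRings_ringsUpTo {s : ℝ} {y : ℕ → ℝ × Bool} (hy : ∃ n, s < clock y (n + 1)) :
    y ∈ exactRings (ringsUpTo s y) s :=
  ⟨fun _ hi => not_lt.mp (Nat.notMem_of_lt_sInf hi),
    Nat.sInf_mem (s := {n | s < clock y (n + 1)}) hy⟩

lemma ClockRegular.exists_lt_clock {y : ℕ → ℝ × Bool} (hy : ClockRegular y) (s : ℝ) :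
    ∃ n, s < clock y (n + 1) :=
  (((tendsto_add_atTop_iff_nat 1).mpr hy.2).eventually_gt_atTop s).exists

lemma measurable_siteShift (s : ℝ) : Measurable (siteShift s) := by
  have hN : Measurable (ringsUpTo s) := by
    refine measurable_to_countable' fun n => ?_
    -- The second set takes care of clocks that never ring after time `s`, where the infimum is `0`.
    have : ringsUpTo s ⁻¹' {n} = exactRings n s ∪
        ((⋂ k, {y | clock y (k + 1) ≤ s}) ∩ {_y | n = 0}) := by
      ext y
      simp only [mem_preimage, mem_singleton_iff, mem_union, mem_inter_iff, mem_iInter,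
        mem_ofPred_eq]
      by_cases hy : ∃ k, s < clock y (k + 1)
      · have hy' : ¬ ∀ k, clock y (k + 1) ≤ s := by push Not; exact hy
        simp only [hy', false_and, or_false]
        exact ⟨fun h => h ▸ mem_exactRings_ringsUpTo hy, ringsUpTo_eq_of_mem_exactRings⟩
      · have h0 : ringsUpTo s y = 0 := by
          rw [ringsUpTo, show {n | s < clock y (n + 1)} = ∅ by
            ext k; simp only [mem_ofPred_eq, mem_empty_iff_false, iff_false]
            exact fun h => hy ⟨k, h⟩, Nat.sInf_empty]
        have h1 : y ∉ exactRings n s := fun h => hy ⟨n, h.2⟩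
        push Not at hy
        simp [h0, h1, hy, eq_comm]
    rw [this]
    exact (measurableSet_exactRings n s).union ((MeasurableSet.iInter fun k =>
      measurableSet_le (measurable_clock _) measurable_const).inter (.const _))
  exact (measurable_from_prod_countable_right (f := fun p : ℕ × (ℕ → ℝ × Bool) =>
    shiftAt p.1 s p.2) fun n => measurable_shiftAt n s).comp (hN.prodMk measurable_id)

/-- The event that the clock rings at least `m` times by time `s` and that its first `m` marks lie
in prescribed sets. -/
def history (m : ℕ) (s : ℝ) (b : ℕ → Set (ℝ × Bool)) : Set (ℕ → ℝ × Bool) :=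
  {y | (∀ i < m, clock y (i + 1) ≤ s) ∧ ∀ i < m, y i ∈ b i}

lemma measurableSet_history (m : ℕ) (s : ℝ) {b : ℕ → Set (ℝ × Bool)}
    (hb : ∀ i, MeasurableSet (b i)) : MeasurableSet (history m s b) := by
  have : history m s b = (⋂ i, ⋂ _ : i < m, {y | clock y (i + 1) ≤ s}) ∩
      ⋂ i, ⋂ _ : i < m, {y | y i ∈ b i} := by
    ext; simp [history]
  rw [this]
  exact (MeasurableSet.iInter fun i => .iInter fun _ =>
    measurableSet_le (measurable_clock _) measurable_const).inter
    (.iInter fun i => .iInter fun _ => measurable_pi_apply i (hb i))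

/-- The marks seen from time `s` have the original law and are independent of the first `m` marks,
on the event that `m` rings have occurred by time `s`. -/
lemma siteLaw_history_inter_siteShift (m : ℕ) {s : ℝ} (hs : 0 ≤ s) {b : ℕ → Set (ℝ × Bool)}
    (hb : ∀ i, MeasurableSet (b i)) {A : Set (ℕ → ℝ × Bool)} (hA : MeasurableSet A) :
    siteLaw (history m s b ∩ siteShift s ⁻¹' A) = siteLaw (history m s b) * siteLaw A := by
  classical
  have hdecomp : ∀ T : Set (ℕ → ℝ × Bool), MeasurableSet T →
      siteLaw T = ∑' n, siteLaw (T ∩ exactRings n s) := fun T hT => by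
    rw [← measure_iUnion _ fun n => hT.inter (measurableSet_exactRings n s), ← inter_iUnion]
    · refine (measure_inter_conull ?_).symm
      refine measure_mono_null ?_ ae_clockRegular
      intro y hy hy'
      exact hy (mem_iUnion.mpr ⟨_, mem_exactRings_ringsUpTo (hy'.exists_lt_clock s)⟩)
    · intro i j hij
      refine disjoint_left.mpr fun y hy hy' => hij ?_
      rw [← ringsUpTo_eq_of_mem_exactRings hy.2, ← ringsUpTo_eq_of_mem_exactRings hy'.2]
  have hH := measurableSet_history m s hb
  rw [hdecomp _ (hH.inter (measurable_siteShift s hA)), hdecomp _ hH, ← ENNReal.tsum_mul_right]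
  refine tsum_congr fun n => ?_
  rcases lt_or_ge n m with hnm | hmn
  · have : history m s b ∩ exactRings n s = ∅ := by
      ext y
      simp only [mem_inter_iff, mem_empty_iff_false, iff_false, not_and]
      exact fun h1 h2 => absurd (h1.1 n hnm) (not_le.mpr h2.2)
    rw [inter_right_comm, this, empty_inter, measure_empty, zero_mul]
  · set b' : ℕ → Set (ℝ × Bool) := fun i => if i < m then b i else univ with hb'
    have h1 : history m s b ∩ exactRings n s =
        {y | y ∈ exactRings n s ∧ ∀ i < n, y i ∈ b' i} := by
      ext y
      simp only [history, mem_inter_iff, mem_ofPred_eq, hb']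
      constructor
      · rintro ⟨⟨_, h2⟩, h3⟩
        refine ⟨h3, fun i _ => ?_⟩
        split_ifs with him
        exacts [h2 i him, mem_univ _]
      · rintro ⟨h3, h2⟩
        refine ⟨⟨fun i hi => h3.1 i (by omega), fun i hi => ?_⟩, h3⟩
        simpa [hi] using h2 i (by omega)
    have h2 : history m s b ∩ siteShift s ⁻¹' A ∩ exactRings n s =
        {y | y ∈ exactRings n s ∧ ∀ i < n, y i ∈ b' i} ∩ shiftAt n s ⁻¹' A := by
      rw [inter_right_comm, h1]
      ext y
      refine and_congr_right fun hy => ?_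
      rw [mem_preimage, mem_preimage, siteShift, ringsUpTo_eq_of_mem_exactRings hy.1]
    rw [h1, h2]
    refine siteLaw_exactRings_inter_shiftAt n hs (fun i => ?_) hA
    simp only [hb']
    split_ifs
    exacts [hb i, .univ]

lemma clock_shiftAt (n : ℕ) (s : ℝ) (y : ℕ → ℝ × Bool) (k : ℕ) :
    clock (shiftAt n s y) (k + 1) = clock y (n + k + 1) - s := by
  induction k with
  | zero => simp [shiftAt, clock]
  | succ k ih =>
    rw [clock, Finset.sum_range_succ, ← clock, ih, clock, clock, ← add_assoc,
      Finset.sum_range_succ _ (n + k + 1), shiftAt, seqCons_succ, ← add_assoc]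
    ring

lemma shiftAt_snd (n : ℕ) (s : ℝ) (y : ℕ → ℝ × Bool) (k : ℕ) :
    (shiftAt n s y k).2 = (y (n + k)).2 := by
  cases k <;> rfl

lemma ClockRegular.siteShift_fst_pos {y : ℕ → ℝ × Bool} (hy : ClockRegular y) (s : ℝ) (n : ℕ) :
    0 < (siteShift s y n).1 := by
  cases n with
  | zero => exact sub_pos.mpr (mem_exactRings_ringsUpTo (hy.exists_lt_clock s)).2
  | succ n => exact hy.1 _

lemma siteShift_mem_exactRings {y : ℕ → ℝ × Bool} (hy : ClockRegular y) {s τ : ℝ} (hτ : 0 ≤ τ)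
    {n : ℕ} (hn : y ∈ exactRings n (s + τ)) :
    ringsUpTo s y ≤ n ∧ siteShift s y ∈ exactRings (n - ringsUpTo s y) τ := by
  have hN := mem_exactRings_ringsUpTo (hy.exists_lt_clock s)
  have hle : ringsUpTo s y ≤ n := by
    by_contra! hlt
    linarith [hN.1 n hlt, hn.2]
  refine ⟨hle, fun i hi => ?_, ?_⟩
  · rw [siteShift, clock_shiftAt]
    linarith [hn.1 (ringsUpTo s y + i) (by omega)]
  · rw [siteShift, clock_shiftAt, Nat.add_sub_cancel' hle]
    linarith [hn.2]

/-! ### Stationarity and the zero-one law for the web -/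

/-- The law of the marks of all sites. -/
noncomputable def webLaw : Measure (EvenSite → ℕ → ℝ × Bool) := Measure.infinitePi fun _ => siteLaw

instance : IsProbabilityMeasure webLaw := by unfold webLaw; infer_instance

/-- The marks of all sites seen from dynamical time `s`. -/
noncomputable def webShift (s : ℝ) (x : EvenSite → ℕ → ℝ × Bool) : EvenSite → ℕ → ℝ × Bool :=
  fun z => siteShift s (x z)

lemma measurable_webShift (s : ℝ) : Measurable (webShift s) :=
  measurable_pi_iff.mpr fun z => (measurable_siteShift s).comp (measurable_pi_apply z)

/-- The marks of all sites seen from time `s` have the original law and are independent of the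
marks that finitely many sites have used up by time `s`. -/
lemma webLaw_pi_history_inter_webShift (F : Finset EvenSite) (m : ℕ) {s : ℝ} (hs : 0 ≤ s)
    {b : EvenSite → ℕ → Set (ℝ × Bool)} (hb : ∀ z i, MeasurableSet (b z i))
    {A : Set (EvenSite → ℕ → ℝ × Bool)} (hA : MeasurableSet A) :
    webLaw ((F : Set EvenSite).pi (fun z => history m s (b z)) ∩ webShift s ⁻¹' A) =
      webLaw ((F : Set EvenSite).pi fun z => history m s (b z)) * webLaw A := by
  classical
  set H := (F : Set EvenSite).pi fun z => history m s (b z) with hHdef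
  have hC : ∀ z, MeasurableSet (history m s (b z)) := fun z => measurableSet_history m s (hb z)
  have hH : MeasurableSet H := .pi F.countable_toSet fun z _ => hC z
  rcases eq_or_ne (webLaw H) 0 with h0 | h0
  · rw [h0, zero_mul]
    exact measure_mono_null inter_subset_left h0
  have hmap : (webLaw H)⁻¹ • (webLaw.restrict H).map (webShift s) = webLaw := by
    refine Measure.eq_infinitePi _ fun F' t ht => ?_
    have hT : MeasurableSet ((F' : Set EvenSite).pi t) := .pi F'.countable_toSet fun z _ => ht z
    set C' : EvenSite → Set (ℕ → ℝ × Bool) := fun z => if z ∈ F then history m s (b z) else univ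
      with hC'
    set t' : EvenSite → Set (ℕ → ℝ × Bool) := fun z => if z ∈ F' then t z else univ with ht'
    have ht'm : ∀ z, MeasurableSet (t' z) := fun z => by
      simp only [ht']; split_ifs; exacts [ht z, .univ]
    have hC'm : ∀ z, MeasurableSet (C' z) := fun z => by
      simp only [hC']; split_ifs; exacts [hC z, .univ]
    have hpre : webShift s ⁻¹' (F' : Set EvenSite).pi t ∩ H =
        ((F ∪ F' : Finset EvenSite) : Set EvenSite).pi
          fun z => C' z ∩ siteShift s ⁻¹' t' z := by
      ext x
      simp only [hHdef, mem_inter_iff, mem_preimage, Set.mem_pi, Finset.mem_coe, Finset.mem_union,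
        hC', ht', webShift]
      constructor
      · rintro ⟨h1, h2⟩ z _
        constructor
        · split_ifs with h
          exacts [h2 z h, mem_univ _]
        · split_ifs with h
          exacts [h1 z h, mem_univ _]
      · intro h
        refine ⟨fun z hz => ?_, fun z hz => ?_⟩
        · simpa [hz] using (h z (Or.inr hz)).2
        · simpa [hz] using (h z (Or.inl hz)).1
    have hfac : ∀ z, siteLaw (C' z ∩ siteShift s ⁻¹' t' z) = siteLaw (C' z) * siteLaw (t' z) := by
      intro z
      simp only [hC']
      split_ifs
      · exact siteLaw_history_inter_siteShift m hs (hb z) (ht'm z)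
      · have := siteLaw_history_inter_siteShift 0 hs (hb z) (ht'm z)
        simpa [history] using this
    have hprodC : ∏ z ∈ F ∪ F', siteLaw (C' z) = webLaw H := by
      rw [hHdef, webLaw, Measure.infinitePi_pi _ fun z _ => hC z,
        ← Finset.prod_subset Finset.subset_union_left]
      · exact Finset.prod_congr rfl fun z hz => by simp [hC', hz]
      · intro z _ hz
        simp [hC', hz]
    have hprodt : ∏ z ∈ F ∪ F', siteLaw (t' z) = ∏ z ∈ F', siteLaw (t z) := by
      rw [← Finset.prod_subset Finset.subset_union_right]
      · exact Finset.prod_congr rfl fun z hz => by simp [ht', hz]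
      · intro z _ hz
        simp [ht', hz]
    rw [Measure.smul_apply, Measure.map_apply (measurable_webShift s) hT,
      Measure.restrict_apply (measurable_webShift s hT), hpre, webLaw,
      Measure.infinitePi_pi _ fun z _ => (hC'm z).inter (measurable_siteShift s (ht'm z)),
      Finset.prod_congr rfl fun z _ => hfac z, Finset.prod_mul_distrib, hprodC, hprodt, webLaw,
      smul_eq_mul, ← mul_assoc]
    rw [← webLaw, ENNReal.inv_mul_cancel h0 (measure_ne_top _ _), one_mul]
  have := congrArg (fun μ : Measure (EvenSite → ℕ → ℝ × Bool) => webLaw H * μ A) hmap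
  simp only [Measure.smul_apply, smul_eq_mul, ← mul_assoc,
    ENNReal.mul_inv_cancel h0 (measure_ne_top _ _), one_mul] at this
  rw [← this, Measure.map_apply (measurable_webShift s) hA,
    Measure.restrict_apply (measurable_webShift s hA), inter_comm]

lemma webLaw_preimage_webShift {s : ℝ} (hs : 0 ≤ s) {A : Set (EvenSite → ℕ → ℝ × Bool)}
    (hA : MeasurableSet A) : webLaw (webShift s ⁻¹' A) = webLaw A := by
  have := webLaw_pi_history_inter_webShift ∅ 0 hs (b := fun _ _ => univ) (fun _ _ => .univ) hA
  simpa using this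

/-- Zero-one law: an event is trivial if it almost surely occurs whenever it occurs for the dynamics
seen from a later integer time. By stationarity the two events then agree almost surely, so the
event is independent of the marks used up by any given time, hence of all marks and of itself. -/
theorem webLaw_eq_zero_or_one {E : Set (EvenSite → ℕ → ℝ × Bool)} (hE : MeasurableSet E)
    (hshift : ∀ n : ℕ, ∀ᵐ x ∂webLaw, webShift n x ∈ E → x ∈ E) :
    webLaw E = 0 ∨ webLaw E = 1 := by
  classical
  rcases eq_or_ne (webLaw E) 0 with h0 | h0
  · exact Or.inl h0
  right
  have hae : ∀ n : ℕ, webShift n ⁻¹' E =ᵐ[webLaw] E := fun n =>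
    ae_eq_of_ae_subset_of_measure_ge (hshift n)
      (webLaw_preimage_webShift n.cast_nonneg hE).ge
      (measurable_webShift n hE).nullMeasurableSet (measure_ne_top _ _)
  have hindep : ∀ (S : Finset (EvenSite × ℕ)) (t : EvenSite × ℕ → Set (ℝ × Bool)),
      (∀ p, MeasurableSet (t p)) →
      webLaw ({x | ∀ p ∈ S, x p.1 p.2 ∈ t p} ∩ E) =
        webLaw {x | ∀ p ∈ S, x p.1 p.2 ∈ t p} * webLaw E := by
    intro S t ht
    set F : Finset EvenSite := S.image Prod.fst
    set b : EvenSite → ℕ → Set (ℝ × Bool) := fun z i => if (z, i) ∈ S then t (z, i) else univ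
      with hbdef
    have hb : ∀ z i, MeasurableSet (b z i) := fun z i => by
      simp only [hbdef]; split_ifs; exacts [ht _, .univ]
    set m : ℕ := S.sup Prod.snd + 1 with hm
    have hlt : ∀ p ∈ S, p.2 < m := fun p hp => Nat.lt_succ_of_le (Finset.le_sup (f := Prod.snd) hp)
    -- The events `B n` that the marks in `S` are used up by time `n` and lie in the prescribed sets
    -- increase to the cylinder event.
    set B : ℕ → Set (EvenSite → ℕ → ℝ × Bool) := fun n =>
      (F : Set EvenSite).pi fun z => history m n (b z) with hB
    have hmono : Monotone B := by
      intro n n' hnn x hx z hz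
      have hnn' : (n : ℝ) ≤ n' := by exact_mod_cast hnn
      exact ⟨fun i hi => ((hx z hz).1 i hi).trans hnn', (hx z hz).2⟩
    have hunion : ⋃ n, B n = {x | ∀ p ∈ S, x p.1 p.2 ∈ t p} := by
      ext x
      simp only [mem_iUnion, mem_ofPred_eq]
      constructor
      · rintro ⟨n, hn⟩ ⟨z, i⟩ hp
        have := (hn z (Finset.mem_coe.mpr (Finset.mem_image_of_mem Prod.fst hp))).2 i (hlt _ hp)
        simpa [hbdef, hp] using this
      · intro h
        obtain ⟨n, hn⟩ := exists_nat_ge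
          (∑ z ∈ F, ∑ i ∈ Finset.range m, |clock (x z) (i + 1)|)
        refine ⟨n, fun z hz => ⟨fun i hi => ?_, fun i _ => ?_⟩⟩
        · refine le_trans ?_ hn
          calc clock (x z) (i + 1) ≤ |clock (x z) (i + 1)| := le_abs_self _
            _ ≤ ∑ i ∈ Finset.range m, |clock (x z) (i + 1)| :=
              Finset.single_le_sum (f := fun i => |clock (x z) (i + 1)|)
                (fun _ _ => abs_nonneg _) (Finset.mem_range.mpr hi)
            _ ≤ _ := Finset.single_le_sum
                (f := fun z => ∑ i ∈ Finset.range m, |clock (x z) (i + 1)|)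
                (fun _ _ => Finset.sum_nonneg fun _ _ => abs_nonneg _) hz
        · simp only [hbdef]
          split_ifs with hp
          exacts [h _ hp, mem_univ _]
    have hBE : ∀ n, webLaw (B n ∩ E) = webLaw (B n) * webLaw E := fun n => by
      rw [← webLaw_pi_history_inter_webShift F m n.cast_nonneg hb hE]
      exact measure_congr (EventuallyEq.rfl.inter (hae n).symm)
    rw [← hunion, iUnion_inter]
    have h1 := tendsto_measure_iUnion_atTop (μ := webLaw) hmono
    have h2 := tendsto_measure_iUnion_atTop (μ := webLaw) (s := fun n => B n ∩ E)
      fun n n' h => inter_subset_inter_left E (hmono h)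
    refine tendsto_nhds_unique h2 ?_
    have h3 := ENNReal.Tendsto.mul_const (b := webLaw E) h1 (Or.inr (measure_ne_top _ _))
    exact h3.congr fun n => (hBE n).symm
  -- Conditioning on the event does not change the law, by uniqueness of product measures.
  have hlaw : ((webLaw E)⁻¹ • webLaw.restrict E).map (MeasurableEquiv.curry EvenSite ℕ _).symm =
      webLaw.map (MeasurableEquiv.curry EvenSite ℕ (ℝ × Bool)).symm := by
    have hw : webLaw.map (MeasurableEquiv.curry EvenSite ℕ (ℝ × Bool)).symm =
        Measure.infinitePi fun _ : EvenSite × ℕ => markLaw :=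
      Measure.infinitePi_map_curry_symm fun _ _ => markLaw
    have hpre : ∀ (S : Finset (EvenSite × ℕ)) (t : EvenSite × ℕ → Set (ℝ × Bool)),
        (MeasurableEquiv.curry EvenSite ℕ (ℝ × Bool)).symm ⁻¹' (S : Set (EvenSite × ℕ)).pi t =
          {x | ∀ p ∈ S, x p.1 p.2 ∈ t p} := fun S t => rfl
    rw [hw]
    refine Measure.eq_infinitePi _ fun S t ht => ?_
    have hT : MeasurableSet ((S : Set (EvenSite × ℕ)).pi t) := .pi S.countable_toSet fun p _ => ht p
    rw [← Measure.infinitePi_pi (fun _ : EvenSite × ℕ => markLaw) fun p _ => ht p, ← hw,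
      Measure.map_apply (MeasurableEquiv.measurable _) hT,
      Measure.map_apply (MeasurableEquiv.measurable _) hT, Measure.smul_apply,
      Measure.restrict_apply (MeasurableEquiv.measurable _ hT), hpre, hindep S t ht, smul_eq_mul,
      mul_comm (webLaw _), ← mul_assoc, ENNReal.inv_mul_cancel h0 (measure_ne_top _ _), one_mul]
  have heq := (MeasurableEquiv.map_measurableEquiv_injective _) hlaw
  have := congrArg (fun μ : Measure (EvenSite → ℕ → ℝ × Bool) => μ E) heq
  simp only [Measure.smul_apply, Measure.restrict_apply_self, smul_eq_mul,
    ENNReal.inv_mul_cancel h0 (measure_ne_top _ _)] at this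
  exact this.symm

/-! ### Marks and the canonical web -/

namespace DynamicalDiscreteWeb

variable {Ω : Type*} [MeasurableSpace Ω] {P : Measure Ω}

/-- The marks of all sites in a realization of the web. -/
def marks (W : DynamicalDiscreteWeb Ω P) (ω : Ω) : EvenSite → ℕ → ℝ × Bool :=
  fun z n => (W.gap z n ω, W.arrow z n ω)

lemma measurable_marks (W : DynamicalDiscreteWeb Ω P) : Measurable W.marks :=
  measurable_pi_iff.mpr fun z => measurable_pi_iff.mpr fun n =>
    (W.measurable_gap z n).prodMk (W.measurable_arrow z n)

lemma map_marks [IsProbabilityMeasure P] (W : DynamicalDiscreteWeb Ω P) :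
    P.map W.marks = webLaw := by
  have h1 : P.map (fun ω (i : EvenSite × ℕ) => W.marks ω i.1 i.2) =
      Measure.infinitePi fun _ => markLaw := by
    have := W.indep.map_fun_eq_infinitePi_map fun i : EvenSite × ℕ =>
      (W.measurable_gap i.1 i.2).prodMk (W.measurable_arrow i.1 i.2)
    simp_rw [W.law] at this
    exact this
  have h2 : webLaw = (Measure.infinitePi fun _ : EvenSite × ℕ => markLaw).map
      (MeasurableEquiv.curry EvenSite ℕ (ℝ × Bool)) :=
    (Measure.infinitePi_map_curry fun _ _ => markLaw).symm
  rw [h2, ← h1, Measure.map_map (MeasurableEquiv.measurable _)]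
  · rfl
  · exact measurable_pi_iff.mpr fun i =>
      (W.measurable_gap i.1 i.2).prodMk (W.measurable_arrow i.1 i.2)

/-- The web whose probability space is the space of all marks. -/
def canonical : DynamicalDiscreteWeb (EvenSite → ℕ → ℝ × Bool) webLaw where
  gap z n x := (x z n).1
  arrow z n x := (x z n).2
  measurable_gap z n := by fun_prop
  measurable_arrow z n := by fun_prop
  law z n := by
    have h1 := (measurePreserving_eval_infinitePi (fun _ : EvenSite => siteLaw) z).map_eq
    have h2 := (measurePreserving_eval_infinitePi (fun _ : ℕ => markLaw) n).map_eq
    rw [← siteLaw, ← h1, Measure.map_map (measurable_pi_apply n) (measurable_pi_apply z)] at h2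
    exact h2
  indep := by
    have hmeas : ∀ i : EvenSite × ℕ, Measurable fun x : EvenSite → ℕ → ℝ × Bool => x i.1 i.2 :=
      fun i => by fun_prop
    refine (iIndepFun_iff_map_fun_eq_infinitePi_map hmeas).mpr ?_
    have hw : webLaw.map (MeasurableEquiv.curry EvenSite ℕ (ℝ × Bool)).symm =
        Measure.infinitePi fun _ : EvenSite × ℕ => markLaw :=
      Measure.infinitePi_map_curry_symm fun _ _ => markLaw
    have heval : ∀ i : EvenSite × ℕ, webLaw.map (fun x => x i.1 i.2) = markLaw := fun i => by
      rw [← (measurePreserving_eval_infinitePi (fun _ : EvenSite × ℕ => markLaw) i).map_eq, ← hw,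
        Measure.map_map (measurable_pi_apply i) (MeasurableEquiv.measurable _)]
      rfl
    simp_rw [heval]
    exact hw

/-- The exceptional times of a web are those of the canonical web at its marks. -/
lemma TInfty_eq_canonical (W : DynamicalDiscreteWeb Ω P) (K : ℝ) (ω : Ω) :
    W.TInfty K ω = canonical.TInfty K (W.marks ω) := rfl

/-! ### Regularity of the path in dynamical time -/

lemma ringCount_eq_of_mem_exactRings (W : DynamicalDiscreteWeb Ω P) {ω : Ω} {z : EvenSite}
    (h : ∀ n, 0 < (W.marks ω z n).1) {n : ℕ} {τ : ℝ} (hn : W.marks ω z ∈ exactRings n τ) :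
    W.ringCount ω z τ = n := by
  have : {k : ℕ | W.ringTime ω z k ≤ τ} = (Finset.range n : Set ℕ) := by
    ext k
    simp only [mem_ofPred_eq, Finset.coe_range, mem_Iio]
    refine ⟨fun hk => ?_, fun hk => hn.1 k hk⟩
    by_contra! hnk
    exact absurd (hn.2.trans_le (monotone_clock h (Nat.succ_le_succ hnk))) (not_lt.mpr hk)
  rw [ringCount, this, ncard_coe_finset, Finset.card_range]

lemma mem_exactRings_ringCount (W : DynamicalDiscreteWeb Ω P) {ω : Ω} {z : EvenSite}
    (h : ClockRegular (W.marks ω z)) (τ : ℝ) :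
    W.marks ω z ∈ exactRings (W.ringCount ω z τ) τ := by
  have := mem_exactRings_ringsUpTo (h.exists_lt_clock τ)
  rwa [W.ringCount_eq_of_mem_exactRings h.1 this]

/-- Arrows are right-continuous in dynamical time. -/
lemma eventually_xi_eq_right (W : DynamicalDiscreteWeb Ω P) {ω : Ω} {z : EvenSite}
    (h : ClockRegular (W.marks ω z)) (τ : ℝ) : ∀ᶠ τ' in 𝓝[≥] τ, W.xi ω τ' z = W.xi ω τ z := by
  have hn := W.mem_exactRings_ringCount h τ
  filter_upwards [self_mem_nhdsWithin, nhdsWithin_le_nhds (Iio_mem_nhds hn.2)] with τ' h1 h2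
  rw [xi, W.ringCount_eq_of_mem_exactRings h.1
    (⟨fun i hi => (hn.1 i hi).trans h1, h2⟩ : W.marks ω z ∈ exactRings _ τ'), xi]

/-- Arrows are locally constant in dynamical time away from the rings. -/
lemma eventually_xi_eq (W : DynamicalDiscreteWeb Ω P) {ω : Ω} {z : EvenSite}
    (h : ClockRegular (W.marks ω z)) {τ : ℝ} (hτ : τ ∉ range (W.ringTime ω z)) :
    ∀ᶠ τ' in 𝓝 τ, W.xi ω τ' z = W.xi ω τ z := by
  have hn := W.mem_exactRings_ringCount h τ
  have hlt : ∀ᶠ τ' in 𝓝 τ, ∀ i ∈ Finset.range (W.ringCount ω z τ), W.ringTime ω z i < τ' := by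
    refine (Finset.eventually_all _).mpr fun i hi => Ioi_mem_nhds ?_
    exact lt_of_le_of_ne (hn.1 i (Finset.mem_range.mp hi)) fun he => hτ ⟨i, he⟩
  filter_upwards [hlt, Iio_mem_nhds hn.2] with τ' h1 h2
  rw [xi, W.ringCount_eq_of_mem_exactRings h.1
    (⟨fun i hi => (h1 i (Finset.mem_range.mpr hi)).le, h2⟩ : W.marks ω z ∈ exactRings _ τ'), xi]

lemma S_origin (W : DynamicalDiscreteWeb Ω P) (ω : Ω) (τ : ℝ) (t : ℕ) :
    W.S ω τ EvenSite.origin t =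
      ((fun y : EvenSite => y.next (W.xi ω τ y))^[t] EvenSite.origin).1.1 := by
  simp [S, EvenSite.origin]

/-- The path up to a fixed walk time uses finitely many arrows only, so it inherits the local
constancy of the arrows in dynamical time. -/
lemma eventually_S_eq (W : DynamicalDiscreteWeb Ω P) {ω : Ω} {τ : ℝ} {l : Filter ℝ}
    (h : ∀ z, ∀ᶠ τ' in l, W.xi ω τ' z = W.xi ω τ z) (t : ℕ) :
    ∀ᶠ τ' in l, W.S ω τ' EvenSite.origin t = W.S ω τ EvenSite.origin t := by
  have key : ∀ᶠ τ' in l, (fun y : EvenSite => y.next (W.xi ω τ' y))^[t] EvenSite.origin =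
      (fun y : EvenSite => y.next (W.xi ω τ y))^[t] EvenSite.origin := by
    induction t with
    | zero => simp
    | succ t ih =>
      filter_upwards [ih,
        h ((fun y : EvenSite => y.next (W.xi ω τ y))^[t] EvenSite.origin)] with τ' h1 h2
      simp only [Function.iterate_succ_apply', h1, h2]
  filter_upwards [key] with τ' h'
  rw [S_origin, S_origin, h']

/-! ### Measurability of the dimension -/

lemma measurable_xi (W : DynamicalDiscreteWeb Ω P) (τ : ℝ) (z : EvenSite) :
    Measurable fun ω => W.xi ω τ z := by
  have hring : ∀ n, Measurable fun ω => W.ringTime ω z n := fun n =>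
    Finset.measurable_sum _ fun i _ => W.measurable_gap z i
  have hN : Measurable fun ω => W.ringCount ω z τ :=
    measurable_ncard.comp (measurable_set_iff.mpr fun n =>
      measurableSet_setOfPred.mp (measurableSet_le (hring n) measurable_const))
  exact (measurable_from_prod_countable_right (f := fun p : ℕ × Ω => W.arrow z p.1 p.2)
    fun n => W.measurable_arrow z n).comp (hN.prodMk measurable_id)

lemma measurable_S_origin (W : DynamicalDiscreteWeb Ω P) (τ : ℝ) (t : ℕ) :
    Measurable fun ω => W.S ω τ EvenSite.origin t := by
  have key : Measurable fun ω =>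
      (fun y : EvenSite => y.next (W.xi ω τ y))^[t] EvenSite.origin := by
    induction t with
    | zero => exact measurable_const
    | succ t ih =>
      simp only [Function.iterate_succ_apply']
      exact (measurable_from_prod_countable_right (f := fun p : EvenSite × Ω =>
        p.1.next (W.xi p.2 τ p.1)) fun z => (measurable_of_countable (EvenSite.next z)).comp
          (W.measurable_xi τ z)).comp (ih.prodMk measurable_id)
  simp only [S_origin]
  exact (measurable_of_countable fun z : EvenSite => z.1.1).comp key

/-- The rational dynamical times in `[0, M]` at which the path respects the barrier `j + K √t` up to
walk time `n`. -/
def rationalT (W : DynamicalDiscreteWeb Ω P) (j : ℕ) (K : ℝ) (M n : ℕ) (ω : Ω) : Set ℚ :=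
  {q | (q : ℝ) ∈ Icc (0 : ℝ) M ∧
    ∀ t ≤ n, |(W.S ω q EvenSite.origin (t : ℕ) : ℝ)| ≤ j + K * √(t : ℝ)}

lemma measurableSet_mem_rationalT (W : DynamicalDiscreteWeb Ω P) (j : ℕ) (K : ℝ) (M n : ℕ) (q : ℚ) :
    MeasurableSet {ω | q ∈ W.rationalT j K M n ω} := by
  have : {ω | q ∈ W.rationalT j K M n ω} = {_ω | (q : ℝ) ∈ Icc (0 : ℝ) M} ∩
      ⋂ t : ℕ, ⋂ _ : t ≤ n, {ω | |(W.S ω q EvenSite.origin t : ℝ)| ≤ j + K * √(t : ℝ)} := by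
    ext; simp [rationalT]
  rw [this]
  refine (MeasurableSet.const _).inter (.iInter fun t => .iInter fun _ => ?_)
  exact measurableSet_le ((measurable_of_countable fun k : ℤ => |(k : ℝ)|).comp
    (W.measurable_S_origin q t)) measurable_const

/-- A compact random set which almost surely agrees with `T_j^±(K) ∩ [0, M)` up to a countable
set. -/
def compactT (W : DynamicalDiscreteWeb Ω P) (j : ℕ) (K : ℝ) (M : ℕ) (ω : Ω) : Set ℝ :=
  ⋂ n, closure ((↑) '' W.rationalT j K M n ω)

lemma measurable_dimH_compactT (W : DynamicalDiscreteWeb Ω P) (j : ℕ) (K : ℝ) (M : ℕ) :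
    Measurable fun ω => dimH (W.compactT j K M ω) :=
  measurable_dimH_iInter_closure (fun n q => W.measurableSet_mem_rationalT j K M n q)
    (fun _ _ _ h _ hq => ⟨hq.1, fun t ht => hq.2 t (ht.trans h)⟩) fun _ _ _ hq => hq.1

/-- An exceptional time is approached from the right by rational times with the same path up to any
fixed walk time, because arrows are right-continuous. -/
lemma T_inter_Iio_subset_compactT (W : DynamicalDiscreteWeb Ω P) {ω : Ω}
    (h : ∀ z, ClockRegular (W.marks ω z)) (j : ℕ) (K : ℝ) (M : ℕ) :
    W.T j K ω ∩ Iio (M : ℝ) ⊆ W.compactT j K M ω := by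
  rintro τ ⟨⟨hτ0, hτ⟩, hτM⟩
  refine mem_iInter.mpr fun n => mem_closure_iff_nhds.mpr fun U hU => ?_
  have hS : ∀ᶠ τ' in 𝓝[≥] τ, ∀ t ∈ Finset.range (n + 1),
      W.S ω τ' EvenSite.origin (t : ℕ) = W.S ω τ EvenSite.origin (t : ℕ) :=
    (Finset.eventually_all _).mpr fun t _ =>
      W.eventually_S_eq (fun z => W.eventually_xi_eq_right (h z) τ) t
  have hev : ∀ᶠ τ' in 𝓝[>] τ, τ' ∈ U ∧ τ' < M ∧ ∀ t ∈ Finset.range (n + 1),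
      W.S ω τ' EvenSite.origin (t : ℕ) = W.S ω τ EvenSite.origin (t : ℕ) := by
    filter_upwards [nhdsWithin_le_nhds hU, nhdsWithin_le_nhds (Iio_mem_nhds hτM),
      nhdsWithin_mono τ Ioi_subset_Ici_self hS] with τ' h1 h2 h3 using ⟨h1, h2, h3⟩
  obtain ⟨c, hc, hsub⟩ := mem_nhdsGT_iff_exists_Ioo_subset.mp hev
  obtain ⟨q, hq1, hq2⟩ := exists_rat_btwn (mem_Ioi.mp hc)
  obtain ⟨hqU, hqM, hqS⟩ := hsub ⟨hq1, hq2⟩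
  refine ⟨q, hqU, mem_image_of_mem _ ⟨⟨hτ0.trans hq1.le, hqM.le⟩, fun t ht => ?_⟩⟩
  rw [hqS t (Finset.mem_range_succ_iff.mpr ht)]
  exact hτ t

/-- Taking closures only adds times at which some clock rings. -/
lemma compactT_subset (W : DynamicalDiscreteWeb Ω P) {ω : Ω}
    (h : ∀ z, ClockRegular (W.marks ω z)) (j : ℕ) (K : ℝ) (M : ℕ) :
    W.compactT j K M ω ⊆ W.T j K ω ∪ ⋃ z, range (W.ringTime ω z) := by
  intro τ hτ
  by_cases hR : τ ∈ ⋃ z, range (W.ringTime ω z)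
  · exact Or.inr hR
  left
  rw [mem_iUnion, not_exists] at hR
  have hτn := mem_iInter.mp hτ
  have h0 : τ ∈ Icc (0 : ℝ) M :=
    closure_minimal (by rintro _ ⟨q, hq, rfl⟩; exact hq.1) isClosed_Icc (hτn 0)
  refine ⟨h0.1, fun t => ?_⟩
  obtain ⟨_, hS, ⟨q, hq, rfl⟩⟩ := mem_closure_iff_nhds.mp (hτn t) _
    (W.eventually_S_eq (fun z => W.eventually_xi_eq (h z) (hR z)) t)
  rw [← (show W.S ω q EvenSite.origin (t : ℕ) = _ from hS)]
  exact hq.2 t le_rfl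

lemma dimH_TInfty_eq_iSup (W : DynamicalDiscreteWeb Ω P) {ω : Ω}
    (h : ∀ z, ClockRegular (W.marks ω z)) (K : ℝ) :
    dimH (W.TInfty K ω) = ⨆ (j : ℕ) (M : ℕ), dimH (W.compactT j K M ω) := by
  rw [TInfty, dimH_iUnion]
  refine iSup_congr fun j => le_antisymm ?_ (iSup_le fun M => ?_)
  · have hT : W.T j K ω ⊆ ⋃ M : ℕ, W.T j K ω ∩ Iio (M : ℝ) := fun τ hτ => by
      obtain ⟨M, hM⟩ := exists_nat_gt τ
      exact mem_iUnion.mpr ⟨M, hτ, hM⟩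
    refine (dimH_mono hT).trans ?_
    rw [dimH_iUnion]
    exact iSup_mono fun M => dimH_mono (W.T_inter_Iio_subset_compactT h j K M)
  · refine (dimH_mono (W.compactT_subset h j K M)).trans ?_
    rw [dimH_union, dimH_countable (countable_iUnion fun z => countable_range _), max_eq_left]
    exact zero_le

/-! ### The exceptional times seen from a later dynamical time -/

/-- Advancing the marks by `s` amounts to looking at the arrows `s` units of dynamical time
later. -/
lemma canonical_xi_webShift {x : EvenSite → ℕ → ℝ × Bool} {z : EvenSite}
    (h : ClockRegular (x z)) {s τ : ℝ} (hτ : 0 ≤ τ) :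
    canonical.xi (webShift s x) τ z = canonical.xi x (s + τ) z := by
  have hn : x z ∈ exactRings _ (s + τ) := canonical.mem_exactRings_ringCount h (s + τ)
  obtain ⟨hle, hmem⟩ := siteShift_mem_exactRings h hτ hn
  rw [xi, canonical.ringCount_eq_of_mem_exactRings (ω := webShift s x)
    (fun n => h.siteShift_fst_pos s n) hmem]
  refine (shiftAt_snd _ _ _ _).trans ?_
  rw [Nat.add_sub_cancel' hle]
  rfl

/-- The exceptional times after `s`, translated by `s`, are the exceptional times of the shifted
marks; hence a shift of the marks can only lower the dimension. -/
lemma dimH_TInfty_webShift_le {x : EvenSite → ℕ → ℝ × Bool} (h : ∀ z, ClockRegular (x z)) (K : ℝ)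
    {s : ℝ} (hs : 0 ≤ s) :
    dimH (canonical.TInfty K (webShift s x)) ≤ dimH (canonical.TInfty K x) := by
  rw [← (IsometryEquiv.addLeft s).dimH_preimage (canonical.TInfty K x)]
  refine dimH_mono fun τ hτ => ?_
  obtain ⟨j, hτ0, hj⟩ := mem_iUnion.mp hτ
  refine mem_iUnion.mpr ⟨j, add_nonneg hs hτ0, fun t => ?_⟩
  have hxi : canonical.xi (webShift s x) τ = canonical.xi x (s + τ) :=
    funext fun z => canonical_xi_webShift (h z) hτ0
  have := hj t
  rw [S_origin, hxi] at this
  rw [S_origin]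
  exact this

lemma ae_clockRegular_webLaw : ∀ᵐ x ∂webLaw, ∀ z, ClockRegular (x z) :=
  ae_all_iff.mpr fun z => (measurePreserving_eval_infinitePi
    (fun _ : EvenSite => siteLaw) z).quasiMeasurePreserving.ae ae_clockRegular

/-- The dimension of the exceptional times of the canonical web is almost surely constant. -/
lemma exists_ae_dimH_TInfty_canonical_eq (K : ℝ) :
    ∃ d : ℝ≥0∞, ∀ᵐ x ∂webLaw, dimH (canonical.TInfty K x) = d := by
  set D : (EvenSite → ℕ → ℝ × Bool) → ℝ≥0∞ :=
    fun x => ⨆ (j : ℕ) (M : ℕ), dimH (canonical.compactT j K M x) with hD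
  have hDm : Measurable D :=
    .iSup fun j => .iSup fun M => canonical.measurable_dimH_compactT j K M
  have hDT : ∀ᵐ x ∂webLaw, dimH (canonical.TInfty K x) = D x := by
    filter_upwards [ae_clockRegular_webLaw] with x hx
    exact canonical.dimH_TInfty_eq_iSup hx K
  have hshift : ∀ n : ℕ, ∀ᵐ x ∂webLaw, D (webShift n x) ≤ D x := fun n => by
    have hqmp : Measure.QuasiMeasurePreserving (webShift n) webLaw webLaw :=
      ⟨measurable_webShift n, Measure.AbsolutelyContinuous.mk fun s hs h0 => by
        rw [Measure.map_apply (measurable_webShift n) hs,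
          webLaw_preimage_webShift n.cast_nonneg hs, h0]⟩
    filter_upwards [ae_clockRegular_webLaw, hDT, hqmp.ae hDT] with x hx h1 h2
    rw [← h1, ← h2]
    exact dimH_TInfty_webShift_le hx K n.cast_nonneg
  have hsep : HasCountableSeparatingOn ℝ≥0∞ (· ∈ range Ioi) univ :=
    HasCountableSeparatingOn.range_Ioi
  obtain ⟨d, hd⟩ := exists_eventuallyEq_const_of_forall_separating (l := ae webLaw) (f := D)
    (· ∈ range Ioi) (by
      rintro _ ⟨c, rfl⟩
      have hE : MeasurableSet (D ⁻¹' Ioi c) := hDm measurableSet_Ioi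
      rcases webLaw_eq_zero_or_one hE fun n => by
        filter_upwards [hshift n] with x hx h using lt_of_lt_of_le h hx with h0 | h1
      · exact Or.inr (measure_eq_zero_iff_ae_notMem.mp h0)
      · exact Or.inl ((mem_ae_iff_prob_eq_one (μ := webLaw) hE).mpr h1))
  refine ⟨d, ?_⟩
  filter_upwards [hDT, hd] with x h1 h2
  rw [h1, h2]
  rfl

/-! ### Eventual and permanent subdiffusivity -/

lemma abs_S_origin_le (W : DynamicalDiscreteWeb Ω P) (ω : Ω) (τ : ℝ) (t : ℕ) :
    |(W.S ω τ EvenSite.origin t : ℝ)| ≤ t := by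
  rw [S_origin]
  induction t with
  | zero => simp [EvenSite.origin]
  | succ t ih =>
    rw [Function.iterate_succ_apply']
    set y := (fun y : EvenSite => y.next (W.xi ω τ y))^[t] EvenSite.origin
    rw [abs_le] at ih ⊢
    cases h : W.xi ω τ y <;> simp only [EvenSite.next] <;> push_cast <;>
      constructor <;> simp <;> linarith

/-- Raising the barrier by a constant removes the constraint at any finite set of walk times, so
eventual and permanent `K`-subdiffusivity are the same. -/
lemma THat_eq_TInfty (W : DynamicalDiscreteWeb Ω P) (K : ℝ) (ω : Ω) :
    W.THat K ω = W.TInfty K ω := by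
  ext τ
  constructor
  · rintro ⟨h0, N, j, h⟩
    obtain ⟨m, hm⟩ := exists_nat_ge (|K| * √(N : ℝ))
    refine mem_iUnion.mpr ⟨j + N + m, h0, fun t => ?_⟩
    push_cast
    have hj : (0 : ℝ) ≤ j := j.cast_nonneg
    have hN : (0 : ℝ) ≤ N := N.cast_nonneg
    have hm0 : (0 : ℝ) ≤ m := m.cast_nonneg
    rcases le_or_gt N t with hNt | htN
    · linarith [h t hNt]
    · have htN' : (t : ℝ) ≤ N := by exact_mod_cast htN.le
      have h1 : |K| * √(t : ℝ) ≤ |K| * √(N : ℝ) := by gcongr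
      have h2 : -(|K| * √(t : ℝ)) ≤ K * √(t : ℝ) := by
        rw [← neg_mul]
        exact mul_le_mul_of_nonneg_right (neg_abs_le K) (Real.sqrt_nonneg _)
      linarith [W.abs_S_origin_le ω τ t]
  · intro h
    obtain ⟨j, h0, hj⟩ := mem_iUnion.mp h
    exact ⟨h0, 0, j, fun t _ => hj t⟩

end DynamicalDiscreteWeb

end AlmostSureDimension

/-- For every `K` there is a constant `d`, depending on `K` only, that is almost surely the Hausdorff
dimension both of the set of eventually `K`-subdiffusive times and of `T^±(K)`. -/
theorem mainTheorem8 (K : ℝ) :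
    ∃ d : ℝ≥0∞, ∀ (Ω : Type*) [MeasurableSpace Ω] (P : Measure Ω) [IsProbabilityMeasure P]
      (W : DynamicalDiscreteWeb Ω P),
      (∀ᵐ ω ∂P, dimH (W.THat K ω) = d) ∧ (∀ᵐ ω ∂P, dimH (W.TInfty K ω) = d) := by
  obtain ⟨d, hd⟩ := DynamicalDiscreteWeb.exists_ae_dimH_TInfty_canonical_eq K
  refine ⟨d, fun Ω _ P _ W => ?_⟩
  have hT : ∀ᵐ ω ∂P, dimH (W.TInfty K ω) = d := by
    have hq : Measure.QuasiMeasurePreserving W.marks P webLaw :=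
      ⟨W.measurable_marks, W.map_marks.absolutelyContinuous⟩
    filter_upwards [hq.ae hd] with ω hω
    rw [W.TInfty_eq_canonical]
    exact hω
  refine ⟨?_, hT⟩
  simpa only [W.THat_eq_TInfty] using hT
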